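/- Let $\mathcal P_n$ denote the space of real algebraic polynomials of total degree at most $n$ in $d$ variables. For a compact set $D\subset\mathbb R^d$ of positive Lebesgue measure and ${x}\in\mathbb R^d$, put $$C(\mathcal P_n,D,x)=\sum_{k=1}^N\phi_k(x)^2,$$ where $\{\phi_k\}_{k=1}^N$ is a basis of $\mathcal P_n$ that is orthonormal in $L_2(D)$ with respect to Lebesgue measure (the sum does not depend on the choice of this basis; it is the reciprocal of the Christoffel function). **Theorem.** Let $d\ge 2$ and let $\alpha,\beta>0$. There is a constant $c>0$, depending only on $\alpha$, $\beta$ and $d$, such that the following holds. Let $s\in[\frac12,1]$, let $D\subset\mathbb R^d$ be compact, let $x\in D$, let $u\in\mathbb R^d$ be a vector of unit length, and suppose that $$\{x+\delta u+\lambda\delta^s v:\ \delta\in[0,\alpha],\ \lambda\in[0,\beta],\ v\in\mathbb R^d,\ |v|=1,\ u\perp v\}\subset D.$$ Then, for every integer $n\ge1$, $\mathcal P_n$ has a basis that is orthonormal in $L_2(D)$ (so $C(\mathcal P_n,D,x)$ is defined), and $$C(\mathcal P_n,D,x)\le c\,n^{2+2s(d-1)}.$$ -/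

import Mathlib

open MeasureTheory

noncomputable section

/-- The space of real algebraic polynomials of total degree at most `n` in `d` variables, as a
space of functions on `ℝ^d`. -/
def polySpace (d n : ℕ) : Submodule ℝ (EuclideanSpace ℝ (Fin d) → ℝ) where
  carrier := {f | ∃ p : MvPolynomial (Fin d) ℝ, p.totalDegree ≤ n ∧
    ∀ x : EuclideanSpace ℝ (Fin d), f x = MvPolynomial.eval (fun i => x i) p}
  add_mem' := by
    rintro f g ⟨p, hp, hf⟩ ⟨q, hq, hg⟩
    exact ⟨p + q, (MvPolynomial.totalDegree_add p q).trans (max_le hp hq),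
      fun x => by simp [hf, hg]⟩
  zero_mem' := ⟨0, by simp, fun x => by simp⟩
  smul_mem' := by
    rintro a f ⟨p, hp, hf⟩
    exact ⟨a • p, (MvPolynomial.totalDegree_smul_le a p).trans hp,
      fun x => by simp [hf, MvPolynomial.smul_eval]⟩

/-- `φ` is a basis of the function space `S` that is orthonormal on `D` with respect to `μ`.
(Linear independence follows from orthonormality.) -/
structure IsOrthonormalBasisOn {E : Type*} [MeasurableSpace E] (S : Submodule ℝ (E → ℝ))
    (D : Set E) (μ : Measure E) {N : ℕ} (φ : Fin N → E → ℝ) : Prop where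
  span_eq : Submodule.span ℝ (Set.range φ) = S
  integrableOn : ∀ i j, IntegrableOn (fun y => φ i y * φ j y) D μ
  orthonormal : ∀ i j, ∫ y in D, φ i y * φ j y ∂μ = if i = j then 1 else 0

/-- `S` has a basis that is orthonormal on `D` with respect to `μ`. -/
def HasOrthonormalBasisOn {E : Type*} [MeasurableSpace E] (S : Submodule ℝ (E → ℝ))
    (D : Set E) (μ : Measure E) : Prop :=
  ∃ (N : ℕ) (φ : Fin N → E → ℝ), IsOrthonormalBasisOn S D μ φ

open Classical in
/-- The reciprocal `C(S, D, μ, x) = λ(S, D, μ, x)⁻¹` of the Christoffel function: the sum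
`∑ k, φ k x ^ 2` over an orthonormal basis `φ` of `S` on `D` with respect to `μ`
(junk value `0` if there is no such basis). -/
def christoffelC {E : Type*} [MeasurableSpace E] (S : Submodule ℝ (E → ℝ))
    (D : Set E) (μ : Measure E) (x : E) : ℝ :=
  if h : HasOrthonormalBasisOn S D μ then ∑ k, (h.choose_spec.choose k x) ^ 2 else 0

theorem IsOrthonormalBasisOn.expansion {E : Type*} [MeasurableSpace E]
    {S : Submodule ℝ (E → ℝ)} {D : Set E} {μ : Measure E} {N : ℕ} {φ : Fin N → E → ℝ}
    (h : IsOrthonormalBasisOn S D μ φ) {f : E → ℝ} (hf : f ∈ S) (x : E) :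
    f x = ∑ i, (∫ y in D, f y * φ i y ∂μ) * φ i x := by
  rw [← h.span_eq] at hf
  obtain ⟨c, rfl⟩ := (Submodule.mem_span_range_iff_exists_fun ℝ).1 hf
  have key : ∀ i, ∫ y in D, (∑ k, c k • φ k) y * φ i y ∂μ = c i := by
    intro i
    have e : ∀ y, (∑ k, c k • φ k) y * φ i y = ∑ k, c k * (φ k y * φ i y) := by
      intro y
      simp [Finset.sum_apply, Finset.sum_mul, mul_assoc]
    simp_rw [e]
    rw [integral_finsetSum _ (fun k _ => (h.integrableOn k i).const_mul (c k))]
    simp [integral_const_mul, h.orthonormal]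
  simp_rw [key]
  simp [Finset.sum_apply]

/-- `C(S, D, μ, x)` does not depend on the choice of the orthonormal basis. -/
theorem IsOrthonormalBasisOn.christoffelC_eq {E : Type*} [MeasurableSpace E]
    {S : Submodule ℝ (E → ℝ)} {D : Set E} {μ : Measure E} {N : ℕ} {φ : Fin N → E → ℝ}
    (h : IsOrthonormalBasisOn S D μ φ) (x : E) :
    christoffelC S D μ x = ∑ k, (φ k x) ^ 2 := by
  have hex : HasOrthonormalBasisOn S D μ := ⟨N, φ, h⟩
  rw [christoffelC, dif_pos hex]
  have h' := hex.choose_spec.choose_spec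
  generalize hex.choose_spec.choose = ψ at h' ⊢
  have hφ : ∀ i, φ i ∈ S := fun i => h.span_eq ▸ Submodule.subset_span ⟨i, rfl⟩
  have hψ : ∀ j, ψ j ∈ S := fun j => h'.span_eq ▸ Submodule.subset_span ⟨j, rfl⟩
  calc ∑ j, (ψ j x) ^ 2
      = ∑ j, ∑ i, (∫ y in D, φ i y * ψ j y ∂μ) * φ i x * ψ j x := by
        refine Finset.sum_congr rfl fun j _ => ?_
        rw [pow_two]
        nth_rewrite 1 [h.expansion (hψ j) x]
        rw [Finset.sum_mul]
        simp_rw [mul_comm (ψ j _) (φ _ _)]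
    _ = ∑ i, ∑ j, (∫ y in D, φ i y * ψ j y ∂μ) * φ i x * ψ j x := Finset.sum_comm
    _ = ∑ i, (φ i x) ^ 2 := by
        refine Finset.sum_congr rfl fun i _ => ?_
        rw [pow_two]
        nth_rewrite 3 [h'.expansion (hφ i) x]
        rw [Finset.mul_sum]
        refine Finset.sum_congr rfl fun j _ => ?_
        ring

/-- The cone-type set
`{x + δ u + λ δ^s v : δ ∈ [0, α], λ ∈ [0, β], v ∈ ℝ^d, |v| = 1, u ⟂ v}`. -/
def coneTypeSet {d : ℕ} (x u : EuclideanSpace ℝ (Fin d)) (α β s : ℝ) :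
    Set (EuclideanSpace ℝ (Fin d)) :=
  {y | ∃ δ ∈ Set.Icc 0 α, ∃ l ∈ Set.Icc 0 β, ∃ v : EuclideanSpace ℝ (Fin d),
    ‖v‖ = 1 ∧ inner ℝ u v = 0 ∧ y = x + δ • u + (l * δ ^ s) • v}

end

open Polynomial Polynomial.Chebyshev in
/-- A polynomial of degree less than `N` is a combination of the first `N` Chebyshev polynomials. -/
theorem Polynomial.exists_eq_sum_chebyshevT (R : ℝ[X]) {N : ℕ} (hR : R.degree < N) :
    ∃ c : Fin N → ℝ, R = ∑ k, c k • T ℝ ((k : ℕ) : ℤ) := by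
  have hmem : R ∈ Submodule.span ℝ (chebyshevTsequence ℝ '' Set.Iio N) := by
    rw [Sequence.span_degreeLT (chebyshevTsequence ℝ) (by simp)]
    exact mem_degreeLT.2 hR
  have himg : chebyshevTsequence ℝ '' Set.Iio N
      = Set.range fun k : Fin N => T ℝ ((k : ℕ) : ℤ) := by
    ext p
    constructor
    · rintro ⟨k, hk, rfl⟩
      exact ⟨⟨k, hk⟩, rfl⟩
    · rintro ⟨k, rfl⟩
      exact ⟨k, k.2, rfl⟩
  rw [himg] at hmem
  obtain ⟨c, hc⟩ := (Submodule.mem_span_range_iff_exists_fun ℝ).1 hmem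
  exact ⟨c, hc.symm⟩

open Polynomial Polynomial.Chebyshev in
/-- Bessel-type bound for Chebyshev coefficients. -/
theorem Polynomial.sum_sq_le_integral_measureT {N : ℕ} (c : Fin N → ℝ) :
    ∑ k, c k ^ 2 ≤ ∫ t, (∑ k, c k • T ℝ ((k : ℕ) : ℤ)).eval t ^ 2 ∂measureT := by
  have hint (p : ℝ[X]) : Integrable (fun t => p.eval t) measureT :=
    integrable_measureT p.continuous.continuousOn
  have hexp : ∀ t, (∑ k, c k • T ℝ ((k : ℕ) : ℤ)).eval t ^ 2
      = ∑ k, ∑ l, c k * c l * ((T ℝ ((k : ℕ) : ℤ)).eval t * (T ℝ ((l : ℕ) : ℤ)).eval t) := by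
    intro t
    rw [pow_two, eval_finsetSum, Finset.sum_mul_sum]
    refine Finset.sum_congr rfl fun k _ => Finset.sum_congr rfl fun l _ => ?_
    simp only [eval_smul, smul_eq_mul]
    ring
  have hint2 (k l : Fin N) : Integrable (fun t => c k * c l *
      ((T ℝ ((k : ℕ) : ℤ)).eval t * (T ℝ ((l : ℕ) : ℤ)).eval t)) measureT := by
    simpa using (hint (T ℝ ((k : ℕ) : ℤ) * T ℝ ((l : ℕ) : ℤ))).const_mul (c k * c l)
  simp_rw [hexp]
  rw [integral_finsetSum _ fun k _ => integrable_finsetSum _ fun l _ => hint2 k l]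
  refine Finset.sum_le_sum fun k _ => ?_
  rw [integral_finsetSum _ fun l _ => hint2 k l, Finset.sum_eq_single k]
  · rw [integral_const_mul, ← pow_two]
    refine le_mul_of_one_le_right (sq_nonneg _) ?_
    have hpi := Real.pi_gt_three
    by_cases hk : (k : ℕ) = 0
    · have h := integral_eval_T_real_mul_self_measureT_zero
      simp only [hk, Nat.cast_zero]
      linarith
    · rw [integral_T_real_mul_self_measureT_of_ne_zero hk]
      linarith
  · intro l _ hl
    rw [integral_const_mul, integral_eval_T_real_mul_eval_T_real_measureT_of_ne
      fun h => hl (Fin.ext h).symm, mul_zero]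
  · simp

open Polynomial Polynomial.Chebyshev in
theorem Polynomial.eval_sq_le_integral_measureT (R : ℝ[X]) {N : ℕ} (hR : R.degree < N) {t : ℝ}
    (ht : |t| ≤ 1) : R.eval t ^ 2 ≤ N * ∫ y, R.eval y ^ 2 ∂measureT := by
  obtain ⟨c, hc⟩ := R.exists_eq_sum_chebyshevT hR
  have hT : ∑ k : Fin N, (T ℝ ((k : ℕ) : ℤ)).eval t ^ 2 ≤ N := by
    calc ∑ k : Fin N, (T ℝ ((k : ℕ) : ℤ)).eval t ^ 2 ≤ ∑ k : Fin N, 1 := by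
          refine Finset.sum_le_sum fun k _ => ?_
          rw [← Real.cos_arccos (abs_le.1 ht).1 (abs_le.1 ht).2, T_real_cos]
          exact Real.cos_sq_le_one _
      _ = N := by simp
  calc R.eval t ^ 2 = (∑ k, c k * (T ℝ ((k : ℕ) : ℤ)).eval t) ^ 2 := by
        rw [hc, eval_finsetSum]
        simp
    _ ≤ (∑ k, c k ^ 2) * ∑ k : Fin N, (T ℝ ((k : ℕ) : ℤ)).eval t ^ 2 :=
        Finset.sum_mul_sq_le_sq_mul_sq _ _ _
    _ ≤ (∫ y, R.eval y ^ 2 ∂measureT) * N := by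
        have h := sum_sq_le_integral_measureT c
        rw [← hc] at h
        have h0 : 0 ≤ ∑ k, c k ^ 2 := Finset.sum_nonneg fun _ _ => sq_nonneg _
        exact mul_le_mul h hT (Finset.sum_nonneg fun _ _ => sq_nonneg _) (h0.trans h)
    _ = _ := mul_comm _ _

open Polynomial Polynomial.Chebyshev in
/-- In the middle half of `[-1, 1]`, the reciprocal Christoffel function of Lebesgue measure grows
at most linearly with the degree. -/
theorem Polynomial.eval_sq_le_integral (Q : ℝ[X]) {m : ℕ} (hQ : Q.natDegree ≤ m) {t : ℝ}
    (ht : |t| ≤ 1 / 2) :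
    Q.eval t ^ 2 ≤ 2 * (m + 3) * ∫ y in Set.Icc (-1 : ℝ) 1, Q.eval y ^ 2 := by
  have hdeg : ((1 - X ^ 2) * Q).degree < ((m + 3 : ℕ) : WithBot ℕ) := by
    refine lt_of_le_of_lt degree_le_natDegree ?_
    have h1 : (1 - X ^ 2 : ℝ[X]).natDegree ≤ 2 := by compute_degree
    exact_mod_cast lt_of_le_of_lt (natDegree_mul_le.trans (add_le_add h1 hQ)) (by omega)
  have hmain := eval_sq_le_integral_measureT _ hdeg (ht.trans (by norm_num))
  have hI : ∫ y, ((1 - X ^ 2) * Q).eval y ^ 2 ∂measureT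
      ≤ ∫ y in Set.Icc (-1 : ℝ) 1, Q.eval y ^ 2 := by
    rw [integral_measureT, intervalIntegral.integral_of_le (by norm_num),
      integral_Icc_eq_integral_Ioc]
    refine integral_mono_of_nonneg (ae_of_all _ fun y => by positivity) ?_ ?_
    · exact (((Q.continuous.pow 2).continuousOn).integrableOn_Icc).mono_set Set.Ioc_subset_Icc_self
    · filter_upwards [ae_restrict_mem measurableSet_Ioc] with y hy
      have h0 : 0 ≤ 1 - y ^ 2 := by nlinarith [hy.1, hy.2]
      have h1 : 1 - y ^ 2 ≤ 1 := by nlinarith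
      have hs : (1 - y ^ 2) * √(1 - y ^ 2)⁻¹ ≤ 1 := by
        rw [Real.sqrt_inv, ← div_eq_mul_inv, Real.div_sqrt]
        exact Real.sqrt_le_one.2 h1
      have hs' : (1 - y ^ 2) * ((1 - y ^ 2) * √(1 - y ^ 2)⁻¹) ≤ 1 :=
        mul_le_one₀ h1 (by positivity) hs
      calc ((1 - X ^ 2) * Q).eval y ^ 2 * √(1 - y ^ 2)⁻¹
          = (1 - y ^ 2) * ((1 - y ^ 2) * √(1 - y ^ 2)⁻¹) * Q.eval y ^ 2 := by
            simp only [eval_mul, eval_sub, eval_one, eval_pow, eval_X]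
            ring
        _ ≤ Q.eval y ^ 2 := mul_le_of_le_one_left (sq_nonneg _) hs'
  have ht2 : t ^ 2 ≤ 1 / 4 := by
    have := abs_le.1 ht
    nlinarith
  have hfac : Q.eval t ^ 2 ≤ 2 * ((1 - X ^ 2) * Q).eval t ^ 2 := by
    simp only [eval_mul, eval_sub, eval_one, eval_pow, eval_X, mul_pow]
    have : 1 ≤ 2 * (1 - t ^ 2) ^ 2 := by nlinarith
    nlinarith [sq_nonneg (Q.eval t)]
  have hm : (0 : ℝ) ≤ ((m + 3 : ℕ) : ℝ) := Nat.cast_nonneg _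
  have := mul_le_mul_of_nonneg_left hI hm
  push_cast at this hmain
  linarith

/-- A Remez-type bound: the value at `0` is controlled by the integral away from a
neighbourhood of `0` of radius comparable to the reciprocal of the degree. -/
theorem Polynomial.eval_zero_sq_le_integral (Q : Polynomial ℝ) {n : ℕ} (hn : 1 ≤ n)
    (hQ : Q.natDegree ≤ 2 * n) :
    Q.eval 0 ^ 2 ≤ 20 * n *
      ∫ y in Set.Icc (-1 : ℝ) 1 \ Set.Ioo (-(1 / (40 * n : ℝ))) (1 / (40 * n)), Q.eval y ^ 2 := by
  have hn' : (1 : ℝ) ≤ n := by exact_mod_cast hn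
  set η : ℝ := 1 / (40 * n) with hη
  have hη0 : 0 < η := by positivity
  have hηn : η * n = 1 / 40 := by rw [hη]; field_simp
  have hη1 : η ≤ 1 / 2 := by nlinarith
  set I := ∫ y in Set.Icc (-1 : ℝ) 1, Q.eval y ^ 2 with hI
  have hI0 : 0 ≤ I := setIntegral_nonneg measurableSet_Icc fun _ _ => sq_nonneg _
  have hpt : ∀ t : ℝ, |t| ≤ 1 / 2 → Q.eval t ^ 2 ≤ 10 * n * I := by
    intro t ht
    refine (Q.eval_sq_le_integral hQ ht).trans (mul_le_mul_of_nonneg_right ?_ hI0)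
    push_cast
    linarith
  have hint : IntegrableOn (fun y => Q.eval y ^ 2) (Set.Icc (-1 : ℝ) 1) :=
    ((Q.continuous.pow 2).continuousOn).integrableOn_Icc
  have hsub : Set.Ioo (-η) η ⊆ Set.Icc (-1) 1 := fun y hy =>
    ⟨by linarith [hy.1], by linarith [hy.2]⟩
  have hsmall : ∫ y in Set.Ioo (-η) η, Q.eval y ^ 2 ≤ I / 2 := by
    calc ∫ y in Set.Ioo (-η) η, Q.eval y ^ 2 ≤ ∫ y in Set.Ioo (-η) η, 10 * n * I := by
          refine setIntegral_mono_on (hint.mono_set hsub)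
            (integrableOn_const measure_Ioo_lt_top.ne) measurableSet_Ioo fun y hy => ?_
          exact hpt y ((abs_lt.2 hy).le.trans hη1)
      _ = 20 * (η * n) * I := by
          rw [setIntegral_const, measureReal_def, Real.volume_Ioo,
            ENNReal.toReal_ofReal (by linarith), smul_eq_mul]
          ring
      _ = I / 2 := by rw [hηn]; ring
  rw [setIntegral_sdiff measurableSet_Ioo hint hsub]
  have h0 := hpt 0 (by simp)
  nlinarith

open ENNReal in
/-- Substitution `δ = α t²` on a set that stays away from `0` and on which `t ↦ t²` is injective. -/
theorem lintegral_comp_mul_sq_le {α η : ℝ} (hα : 0 < α) (hη : 0 < η) {S : Set ℝ}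
    (hS : MeasurableSet S) (hinj : Set.InjOn (fun t : ℝ => t ^ 2) S) (hSη : ∀ t ∈ S, η ≤ |t|)
    (g : ℝ → ℝ≥0∞) :
    ∫⁻ t in S, g (α * t ^ 2) ≤ ENNReal.ofReal (2 * α * η)⁻¹ * ∫⁻ δ, g δ := by
  have hpos : 0 < 2 * α * η := by positivity
  have hcv := lintegral_image_eq_lintegral_abs_deriv_mul (f := fun t => α * t ^ 2)
    (f' := fun t => α * (2 * t)) hS
    (fun t _ => by simpa using ((hasDerivAt_pow 2 t).const_mul α).hasDerivWithinAt)
    (fun a ha b hb hab => hinj ha hb (mul_left_cancel₀ hα.ne' hab)) g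
  have hle : ENNReal.ofReal (2 * α * η) * ∫⁻ t in S, g (α * t ^ 2) ≤ ∫⁻ δ, g δ := by
    rw [← lintegral_const_mul' _ _ ofReal_ne_top]
    calc ∫⁻ t in S, ENNReal.ofReal (2 * α * η) * g (α * t ^ 2)
        ≤ ∫⁻ t in S, ENNReal.ofReal |α * (2 * t)| * g (α * t ^ 2) := by
          refine setLIntegral_mono' hS fun t ht => ?_
          gcongr
          rw [abs_mul, abs_mul, abs_of_pos hα, abs_of_pos (two_pos : (0 : ℝ) < 2)]
          nlinarith [hSη t ht]
      _ = ∫⁻ δ in (fun t => α * t ^ 2) '' S, g δ := hcv.symm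
      _ ≤ ∫⁻ δ, g δ := setLIntegral_le_lintegral _ _
  calc ∫⁻ t in S, g (α * t ^ 2)
      = ENNReal.ofReal (2 * α * η)⁻¹ *
          (ENNReal.ofReal (2 * α * η) * ∫⁻ t in S, g (α * t ^ 2)) := by
        rw [← mul_assoc, ← ofReal_mul (by positivity), inv_mul_cancel₀ hpos.ne', ofReal_one,
          one_mul]
    _ ≤ _ := by gcongr

section Slices

variable {E : Type*} [NormedAddCommGroup E] [InnerProductSpace ℝ E] [FiniteDimensional ℝ E]
  [MeasurableSpace E] [BorelSpace E]

/-- Splitting off the coordinate along a unit vector preserves volume. -/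
theorem measurePreserving_add_smul_add_orthogonal (x : E) {u : E} (hu : ‖u‖ = 1) :
    MeasurePreserving
      (fun p : ℝ × (Submodule.span ℝ {u} : Submodule ℝ E)ᗮ => x + (p.1 • u + (p.2 : E))) := by
  set K : Submodule ℝ E := Submodule.span ℝ {u} with hK
  have h1 : MeasurePreserving (Prod.map (LinearIsometryEquiv.toSpanUnitSingleton (𝕜 := ℝ) u hu)
      (id : Kᗮ → Kᗮ)) :=
    (LinearIsometryEquiv.measurePreserving _).prod (MeasurePreserving.id volume)
  have h2 := WithLp.volume_preserving_toLp K Kᗮ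
  have h3 := K.orthogonalDecomposition.symm.measurePreserving
  have h4 := measurePreserving_add_left (volume : Measure E) x
  exact h4.comp (h3.comp (h2.comp h1))

open ENNReal in
/-- The integral over a family of parabolas with vertex `x` is controlled by the integral over
the whole space, as long as the parabolas are cut off near the vertex. -/
theorem lintegral_parabolas_le (x : E) {u : E} (hu : ‖u‖ = 1) {f : E → ℝ≥0∞} (hf : Measurable f)
    {α η κ : ℝ} (hα : 0 < α) (hη : 0 < η) (hκ : 0 < κ) {k : ℕ}
    (hk : Module.finrank ℝ (Submodule.span ℝ {u} : Submodule ℝ E)ᗮ = k) :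
    ∫⁻ t in Set.Icc (-1 : ℝ) 1 \ Set.Ioo (-η) η,
        ∫⁻ w : (Submodule.span ℝ {u} : Submodule ℝ E)ᗮ,
          f (x + ((α * t ^ 2) • u + (κ * t) • (w : E)))
      ≤ ENNReal.ofReal (((κ * η) ^ k)⁻¹ * (α * η)⁻¹) * ∫⁻ y, f y := by
  set K : Submodule ℝ E := Submodule.span ℝ {u} with hK
  set A := Set.Icc (-1 : ℝ) 1 \ Set.Ioo (-η) η with hA
  have hAm : MeasurableSet A := measurableSet_Icc.diff measurableSet_Ioo
  have hmp := measurePreserving_add_smul_add_orthogonal x hu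
  set g : ℝ → ℝ≥0∞ := fun δ => ∫⁻ w : Kᗮ, f (x + (δ • u + (w : E))) with hg
  have hgint : ∫⁻ δ, g δ = ∫⁻ y, f y := by
    rw [← hmp.lintegral_comp hf]
    exact (lintegral_prod _ (hf.comp hmp.measurable).aemeasurable).symm
  have hAη : ∀ t ∈ A, η ≤ |t| := by
    intro t ht
    by_contra! hlt
    exact ht.2 (abs_lt.1 hlt)
  have hinner : ∀ t ∈ A, ∫⁻ w : Kᗮ, f (x + ((α * t ^ 2) • u + (κ * t) • (w : E)))
      ≤ ENNReal.ofReal ((κ * η) ^ k)⁻¹ * g (α * t ^ 2) := by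
    intro t ht
    have ht0 : κ * t ≠ 0 := mul_ne_zero hκ.ne' (abs_pos.1 (hη.trans_le (hAη t ht)))
    have hmeas : Measurable fun w : Kᗮ => f (x + ((α * t ^ 2) • u + (w : E))) := by
      refine hf.comp ?_
      fun_prop
    have h := lintegral_map (μ := (volume : Measure Kᗮ)) hmeas
      (measurable_const_smul (κ * t) : Measurable fun w : Kᗮ => (κ * t) • w)
    rw [Measure.map_addHaar_smul _ ht0, lintegral_smul_measure, hk] at h
    simp only [Submodule.coe_smul] at h
    rw [← h, smul_eq_mul]
    gcongr
    rw [abs_inv, abs_pow, abs_mul, abs_of_pos hκ]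
    gcongr
    exact hAη t ht
  have hsplit : A ⊆ Set.Ici η ∪ Set.Iic (-η) := by
    intro t ht
    rcases le_abs.1 (hAη t ht) with h | h
    · exact Or.inl h
    · exact Or.inr (by simp only [Set.mem_Iic]; linarith)
  have hpos : ∫⁻ t in Set.Ici η, g (α * t ^ 2) ≤ ENNReal.ofReal (2 * α * η)⁻¹ * ∫⁻ δ, g δ := by
    refine lintegral_comp_mul_sq_le hα hη measurableSet_Ici ?_ (fun t ht => le_abs.2 (Or.inl ht)) g
    intro a ha b hb hab
    exact (pow_left_inj₀ (hη.le.trans ha) (hη.le.trans hb) two_ne_zero).1 hab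
  have hneg : ∫⁻ t in Set.Iic (-η), g (α * t ^ 2)
      ≤ ENNReal.ofReal (2 * α * η)⁻¹ * ∫⁻ δ, g δ := by
    refine lintegral_comp_mul_sq_le hα hη measurableSet_Iic ?_
      (fun t ht => le_abs.2 (Or.inr (le_neg_of_le_neg ht))) g
    intro a ha b hb hab
    simp only [Set.mem_Iic] at ha hb
    have h := (pow_left_inj₀ (by linarith : 0 ≤ -a) (by linarith : 0 ≤ -b) two_ne_zero).1
      (by simpa using hab)
    linarith
  calc ∫⁻ t in A, ∫⁻ w : Kᗮ, f (x + ((α * t ^ 2) • u + (κ * t) • (w : E)))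
      ≤ ∫⁻ t in A, ENNReal.ofReal ((κ * η) ^ k)⁻¹ * g (α * t ^ 2) := setLIntegral_mono' hAm hinner
    _ = ENNReal.ofReal ((κ * η) ^ k)⁻¹ * ∫⁻ t in A, g (α * t ^ 2) :=
        lintegral_const_mul' _ _ ofReal_ne_top
    _ ≤ ENNReal.ofReal ((κ * η) ^ k)⁻¹ *
          ((∫⁻ t in Set.Ici η, g (α * t ^ 2)) + ∫⁻ t in Set.Iic (-η), g (α * t ^ 2)) := by
        gcongr
        exact (lintegral_mono_set hsplit).trans (lintegral_union_le _ _ _)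
    _ ≤ ENNReal.ofReal ((κ * η) ^ k)⁻¹ *
          (ENNReal.ofReal (2 * α * η)⁻¹ * (∫⁻ δ, g δ)
            + ENNReal.ofReal (2 * α * η)⁻¹ * ∫⁻ δ, g δ) := by gcongr
    _ = ENNReal.ofReal (((κ * η) ^ k)⁻¹ * (α * η)⁻¹) * ∫⁻ y, f y := by
        rw [← add_mul, ← ofReal_add (by positivity) (by positivity), ← mul_assoc,
          ← ofReal_mul (by positivity), hgint]
        congr 3
        field_simp
        norm_num

end Slices

/-- A finite-dimensional space of functions on which `f ↦ ∫ y in D, f y ^ 2` is positive definite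
has an orthonormal basis. -/
theorem hasOrthonormalBasisOn_of_posDef {E : Type*} [MeasurableSpace E]
    (S : Submodule ℝ (E → ℝ)) [FiniteDimensional ℝ S] (D : Set E) (μ : Measure E)
    (hint : ∀ f ∈ S, ∀ g ∈ S, IntegrableOn (fun y => f y * g y) D μ)
    (hdef : ∀ f ∈ S, ∫ y in D, f y * f y ∂μ = 0 → f = 0) :
    HasOrthonormalBasisOn S D μ := by
  let core : InnerProductSpace.Core ℝ S :=
    { inner := fun f g => ∫ y in D, (f : E → ℝ) y * (g : E → ℝ) y ∂μ
      conj_inner_symm := fun f g => by simp [mul_comm]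
      re_inner_nonneg := fun f => by
        simpa using integral_nonneg fun y => mul_self_nonneg ((f : E → ℝ) y)
      add_left := fun f g h => by
        simp only [Submodule.coe_add, Pi.add_apply, add_mul]
        exact integral_add (hint _ f.2 _ h.2) (hint _ g.2 _ h.2)
      smul_left := fun f g r => by
        simp [mul_assoc, integral_const_mul]
      definite := fun f hf => Subtype.ext (hdef _ f.2 hf) }
  let : NormedAddCommGroup S := core.toNormedAddCommGroup
  let : InnerProductSpace ℝ S := InnerProductSpace.ofCore core.toCore
  let b := stdOrthonormalBasis ℝ S
  refine ⟨_, fun i => (b i : E → ℝ), ?_, fun i j => hint _ (b i).2 _ (b j).2, fun i j => ?_⟩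
  · have h : Submodule.span ℝ (Set.range b) = ⊤ := by
      simpa using b.toBasis.span_eq
    have h2 := congrArg (Submodule.map S.subtype) h
    rw [Submodule.map_span, ← Set.range_comp, Submodule.map_top, Submodule.range_subtype] at h2
    exact h2
  · exact orthonormal_iff_ite.1 b.orthonormal i j

/-- The extremal property of the reciprocal Christoffel function (upper bound). -/
theorem christoffelC_le_of_sq_le {E : Type*} [MeasurableSpace E] {S : Submodule ℝ (E → ℝ)}
    {D : Set E} {μ : Measure E} (h : HasOrthonormalBasisOn S D μ) (x : E) {M : ℝ} (hM : 0 ≤ M)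
    (hS : ∀ f ∈ S, f x ^ 2 ≤ M * ∫ y in D, f y ^ 2 ∂μ) :
    christoffelC S D μ x ≤ M := by
  obtain ⟨N, φ, hφ⟩ := h
  rw [hφ.christoffelC_eq x]
  set C := ∑ k, φ k x ^ 2 with hC
  have hC0 : 0 ≤ C := Finset.sum_nonneg fun _ _ => sq_nonneg _
  have hmem : (∑ k, φ k x • φ k) ∈ S :=
    S.sum_mem fun k _ => S.smul_mem _ (hφ.span_eq ▸ Submodule.subset_span ⟨k, rfl⟩)
  have hval : (∑ k, φ k x • φ k) x = C := by
    simp [hC, Finset.sum_apply, pow_two]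
  have hnorm : ∫ y in D, (∑ k, φ k x • φ k) y ^ 2 ∂μ = C := by
    have e : ∀ y, (∑ k, φ k x • φ k) y ^ 2 = ∑ k, ∑ l, φ k x * φ l x * (φ k y * φ l y) := by
      intro y
      rw [pow_two, Finset.sum_apply, Finset.sum_mul_sum]
      refine Finset.sum_congr rfl fun k _ => Finset.sum_congr rfl fun l _ => ?_
      simp only [Pi.smul_apply, smul_eq_mul]
      ring
    simp_rw [e]
    rw [integral_finsetSum _ fun k _ => integrable_finsetSum _ fun l _ =>
      (hφ.integrableOn k l).const_mul _]
    refine Finset.sum_congr rfl fun k _ => ?_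
    rw [integral_finsetSum _ fun l _ => (hφ.integrableOn k l).const_mul _]
    simp [integral_const_mul, hφ.orthonormal, pow_two]
  have h := hS _ hmem
  rw [hval, hnorm] at h
  by_contra! hlt
  nlinarith

/-- Restricting a polynomial in `d` variables to a curve parametrized by polynomials of degree
at most `m` gives a polynomial in one variable. -/
theorem exists_polynomial_eval_eq_of_mem_polySpace {d n m : ℕ}
    {f : EuclideanSpace ℝ (Fin d) → ℝ} (hf : f ∈ polySpace d n) (c : Fin d → Polynomial ℝ)
    (hc : ∀ i, (c i).natDegree ≤ m) :
    ∃ Q : Polynomial ℝ, Q.natDegree ≤ n * m ∧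
      ∀ (t : ℝ) (y : EuclideanSpace ℝ (Fin d)), (∀ i, y i = (c i).eval t) → Q.eval t = f y := by
  obtain ⟨p, hp, hfp⟩ := hf
  refine ⟨MvPolynomial.aeval c p, MvPolynomial.aeval_natDegree_le p hp c hc, fun t y hy => ?_⟩
  rw [hfp, funext hy, ← Polynomial.coe_evalRingHom, MvPolynomial.aeval_def,
    MvPolynomial.hom_eval₂]
  rw [MvPolynomial.eval, MvPolynomial.coe_eval₂Hom]
  congr 1
  ext r
  simp

open Polynomial in
/-- The restriction of a polynomial to a parabola. -/
theorem exists_polynomial_eval_parabola {d n : ℕ} {f : EuclideanSpace ℝ (Fin d) → ℝ}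
    (hf : f ∈ polySpace d n) (x v w : EuclideanSpace ℝ (Fin d)) :
    ∃ Q : ℝ[X], Q.natDegree ≤ 2 * n ∧ ∀ t : ℝ, Q.eval t = f (x + (t ^ 2 • v + t • w)) := by
  obtain ⟨Q, hQ, h⟩ := exists_polynomial_eval_eq_of_mem_polySpace hf (m := 2)
    (fun i => C (x i) + (C (v i) * X ^ 2 + C (w i) * X)) fun i => by compute_degree
  exact ⟨Q, by omega, fun t => h t _ fun i => by simp; ring⟩

theorem continuous_of_mem_polySpace {d n : ℕ} {f : EuclideanSpace ℝ (Fin d) → ℝ}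
    (hf : f ∈ polySpace d n) : Continuous f := by
  obtain ⟨p, -, hfp⟩ := hf
  rw [funext hfp]
  exact (MvPolynomial.continuous_eval p).comp (PiLp.continuous_ofLp 2 _)

/-- A polynomial function that vanishes on a nonempty open set vanishes identically. -/
theorem eq_zero_of_mem_polySpace_of_eqOn_open {d n : ℕ} {f : EuclideanSpace ℝ (Fin d) → ℝ}
    (hf : f ∈ polySpace d n) {U : Set (EuclideanSpace ℝ (Fin d))} (hU : IsOpen U)
    (hne : U.Nonempty) (h0 : ∀ y ∈ U, f y = 0) : f = 0 := by
  obtain ⟨z, hz⟩ := hne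
  ext y
  obtain ⟨Q, -, hQ⟩ := exists_polynomial_eval_parabola hf z 0 (y - z)
  have hev : ∀ᶠ t in nhds (0 : ℝ), z + (t ^ 2 • (0 : EuclideanSpace ℝ (Fin d)) + t • (y - z)) ∈ U := by
    have hc : Continuous fun t : ℝ =>
      z + (t ^ 2 • (0 : EuclideanSpace ℝ (Fin d)) + t • (y - z)) := by fun_prop
    exact hc.continuousAt.eventually_mem (hU.mem_nhds (by simpa using hz))
  have hQ0 : Q = 0 := by
    refine Q.eq_zero_of_infinite_isRoot (infinite_of_mem_nhds 0 ?_)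
    filter_upwards [hev] with t ht
    exact (hQ t).trans (h0 _ ht)
  have := hQ 1
  simpa [hQ0] using this.symm

instance finiteDimensional_polySpace (d n : ℕ) : FiniteDimensional ℝ (polySpace d n) := by
  let L : MvPolynomial (Fin d) ℝ →ₗ[ℝ] (EuclideanSpace ℝ (Fin d) → ℝ) :=
    { toFun := fun p x => MvPolynomial.eval (fun i => x i) p
      map_add' := fun p q => by ext; simp
      map_smul' := fun r p => by ext; simp [MvPolynomial.smul_eval] }
  have h : polySpace d n = (MvPolynomial.restrictTotalDegree (Fin d) ℝ n).map L := by
    ext f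
    constructor
    · rintro ⟨p, hp, hf⟩
      exact ⟨p, (MvPolynomial.mem_restrictTotalDegree _ _ _).2 hp, (funext hf).symm⟩
    · rintro ⟨p, hp, rfl⟩
      exact ⟨p, (MvPolynomial.mem_restrictTotalDegree _ _ _).1 hp, fun _ => rfl⟩
  rw [h]
  infer_instance

theorem finrank_orthogonal_span_unit {d : ℕ} (hd : 1 ≤ d) {u : EuclideanSpace ℝ (Fin d)}
    (hu : ‖u‖ = 1) : Module.finrank ℝ
      (Submodule.span ℝ {u} : Submodule ℝ (EuclideanSpace ℝ (Fin d)))ᗮ = d - 1 := by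
  have hu0 : u ≠ 0 := norm_ne_zero_iff.1 (by simp [hu])
  have : Fact (Module.finrank ℝ (EuclideanSpace ℝ (Fin d)) = (d - 1) + 1) := ⟨by simp; omega⟩
  exact Submodule.finrank_orthogonal_span_singleton hu0

theorem nontrivial_orthogonal_span_unit {d : ℕ} (hd : 2 ≤ d) {u : EuclideanSpace ℝ (Fin d)}
    (hu : ‖u‖ = 1) :
    Nontrivial (Submodule.span ℝ {u} : Submodule ℝ (EuclideanSpace ℝ (Fin d)))ᗮ :=
  Module.nontrivial_of_finrank_pos (R := ℝ)
    (by rw [finrank_orthogonal_span_unit (by omega) hu]; omega)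

theorem mem_coneTypeSet_of_norm_le {d : ℕ} (hd : 2 ≤ d) {x u w : EuclideanSpace ℝ (Fin d)}
    {α β s δ : ℝ} (hβ : 0 < β) (hδ : δ ∈ Set.Icc 0 α) (hu : ‖u‖ = 1) (huw : inner ℝ u w = 0)
    (hw : ‖w‖ ≤ β * δ ^ s) : x + (δ • u + w) ∈ coneTypeSet x u α β s := by
  by_cases hw0 : w = 0
  · have := nontrivial_orthogonal_span_unit hd hu
    obtain ⟨v, hv⟩ := exists_norm_eq
      (Submodule.span ℝ {u} : Submodule ℝ (EuclideanSpace ℝ (Fin d)))ᗮ zero_le_one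
    exact ⟨δ, hδ, 0, ⟨le_rfl, hβ.le⟩, v, hv, Submodule.mem_orthogonal_singleton_iff_inner_right.1 v.2,
      by simp [hw0]⟩
  · have hwpos : 0 < ‖w‖ := norm_pos_iff.2 hw0
    have hδs : 0 < δ ^ s := pos_of_mul_pos_right (hwpos.trans_le hw) hβ.le
    refine ⟨δ, hδ, ‖w‖ / δ ^ s, ⟨by positivity, (div_le_iff₀ hδs).2 hw⟩, ‖w‖⁻¹ • w, ?_, ?_, ?_⟩
    · rw [norm_smul, norm_inv, norm_norm, inv_mul_cancel₀ hwpos.ne']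
    · rw [inner_smul_right, huw, mul_zero]
    · rw [smul_smul, div_mul_cancel₀ _ hδs.ne', mul_inv_cancel₀ hwpos.ne', one_smul, add_assoc]

theorem min_one_le_rpow {a s : ℝ} (ha : 0 < a) (hs0 : 0 ≤ s) (hs1 : s ≤ 1) : min a 1 ≤ a ^ s := by
  rcases le_total a 1 with h | h
  · rw [min_eq_left h]
    simpa using Real.rpow_le_rpow_of_exponent_ge ha h hs1
  · rw [min_eq_right h]
    exact Real.one_le_rpow h hs0

/-- Away from the vertex, a narrow parabola lies below the curve `δ ↦ β δ ^ s`. -/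
theorem mul_abs_le_mul_rpow_sq {α β s η t : ℝ} (hα : 0 < α) (hβ : 0 < β)
    (hs : s ∈ Set.Icc (1 / 2 : ℝ) 1) (hη : 0 < η) (ht : η ≤ |t|) :
    β * min α 1 * η ^ (2 * s - 1) * |t| ≤ β * (α * t ^ 2) ^ s := by
  have ht0 : 0 < |t| := hη.trans_le ht
  have h1 : η ^ (2 * s - 1) ≤ |t| ^ (2 * s - 1) :=
    Real.rpow_le_rpow hη.le ht (by linarith [hs.1])
  have h2 : (t ^ 2) ^ s = |t| ^ (2 * s - 1) * |t| := by
    rw [← sq_abs, ← Real.rpow_natCast, ← Real.rpow_mul ht0.le,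
      ← Real.rpow_add_one ht0.ne']
    norm_num
  have h3 := min_one_le_rpow hα (by linarith [hs.1]) hs.2
  rw [Real.mul_rpow hα.le (sq_nonneg t), h2, mul_assoc, mul_assoc]
  gcongr

theorem parabola_constant_le {α β s : ℝ} (hα : 0 < α) (hβ : 0 < β)
    (hs : s ∈ Set.Icc (1 / 2 : ℝ) 1) (k : ℕ) {n : ℕ} (hn : 1 ≤ n) :
    20 * n * (((β * min α 1 * (1 / (40 * n : ℝ)) ^ (2 * s - 1) * (1 / (40 * n))) ^ k)⁻¹
        * (α * (1 / (40 * n)))⁻¹)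
      ≤ 20 * ((β * min α 1) ^ k)⁻¹ * α⁻¹ * 40 ^ (2 * k + 1) * (n : ℝ) ^ (2 + 2 * s * k) := by
  have hn0 : (0 : ℝ) < n := by exact_mod_cast hn
  have hm : 0 < min α 1 := lt_min hα one_pos
  have hN : (0 : ℝ) < 40 * n := by positivity
  have h1 : (1 / (40 * n : ℝ)) ^ (2 * s - 1) * (1 / (40 * n)) = ((40 * n : ℝ) ^ (2 * s))⁻¹ := by
    rw [← Real.rpow_add_one (by positivity), one_div, Real.inv_rpow hN.le]
    norm_num
  have h2 : (((40 * n : ℝ) ^ (2 * s)) ^ k) = (40 : ℝ) ^ (2 * s * k) * (n : ℝ) ^ (2 * s * k) := by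
    rw [← Real.rpow_natCast, ← Real.rpow_mul hN.le, Real.mul_rpow (by norm_num) hn0.le]
  have h3 : (40 : ℝ) ^ (2 * s * k) ≤ 40 ^ (2 * k) := by
    rw [← Real.rpow_natCast]
    refine Real.rpow_le_rpow_of_exponent_le (by norm_num) ?_
    push_cast
    nlinarith [hs.2, Nat.cast_nonneg (α := ℝ) k]
  have h4 : (n : ℝ) ^ (2 + 2 * s * k) = n * n * (n : ℝ) ^ (2 * s * k) := by
    rw [Real.rpow_add hn0, Real.rpow_two, pow_two]
  rw [mul_assoc (β * min α 1), h1, mul_pow, mul_inv, inv_pow, inv_inv, h2, h4]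
  calc 20 * n * (((β * min α 1) ^ k)⁻¹ * ((40 : ℝ) ^ (2 * s * k) * (n : ℝ) ^ (2 * s * k))
        * (α * (1 / (40 * n : ℝ)))⁻¹)
      = 20 * n * (((β * min α 1) ^ k)⁻¹ * ((40 : ℝ) ^ (2 * s * k) * (n : ℝ) ^ (2 * s * k))
        * (α⁻¹ * (40 * n))) := by
        rw [one_div, mul_inv, inv_inv]
    _ ≤ 20 * n * (((β * min α 1) ^ k)⁻¹ * ((40 : ℝ) ^ (2 * k) * (n : ℝ) ^ (2 * s * k))
        * (α⁻¹ * (40 * n))) := by gcongr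
    _ = _ := by ring

theorem integrableOn_mul_of_mem_polySpace {d n : ℕ} {D : Set (EuclideanSpace ℝ (Fin d))}
    (hD : IsCompact D) {f g : EuclideanSpace ℝ (Fin d) → ℝ} (hf : f ∈ polySpace d n)
    (hg : g ∈ polySpace d n) : IntegrableOn (fun y => f y * g y) D :=
  ((continuous_of_mem_polySpace hf).mul
    (continuous_of_mem_polySpace hg)).continuousOn.integrableOn_compact hD

open ENNReal in
/-- The Christoffel-type inequality at the vertex of a cone-type set. -/
theorem sq_le_integral_of_coneTypeSet_subset {d : ℕ} (hd : 2 ≤ d) {α β s : ℝ} (hα : 0 < α)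
    (hβ : 0 < β) (hs : s ∈ Set.Icc (1 / 2 : ℝ) 1) {D : Set (EuclideanSpace ℝ (Fin d))}
    {x u : EuclideanSpace ℝ (Fin d)} (hD : IsCompact D) (hu : ‖u‖ = 1)
    (hcone : coneTypeSet x u α β s ⊆ D) {n : ℕ} (hn : 1 ≤ n)
    {f : EuclideanSpace ℝ (Fin d) → ℝ} (hf : f ∈ polySpace d n) {ω : ℝ} (hω : 0 < ω)
    (hball : volume (Metric.closedBall
      (0 : (Submodule.span ℝ {u} : Submodule ℝ (EuclideanSpace ℝ (Fin d)))ᗮ) 1)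
        = ENNReal.ofReal ω) :
    f x ^ 2 ≤ ω⁻¹ * (20 * ((β * min α 1) ^ (d - 1))⁻¹ * α⁻¹ * 40 ^ (2 * (d - 1) + 1)
      * (n : ℝ) ^ (2 + 2 * s * ((d - 1 : ℕ) : ℝ))) * ∫ y in D, f y ^ 2 := by
  set K : Submodule ℝ (EuclideanSpace ℝ (Fin d)) := Submodule.span ℝ {u} with hK
  have hk : Module.finrank ℝ Kᗮ = d - 1 := finrank_orthogonal_span_unit (by omega) hu
  have hn0 : (0 : ℝ) < n := by exact_mod_cast hn
  set η : ℝ := 1 / (40 * n) with hη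
  have hη0 : 0 < η := by positivity
  set κ : ℝ := β * min α 1 * η ^ (2 * s - 1) with hκ
  have hκ0 : 0 < κ := mul_pos (mul_pos hβ (lt_min hα one_pos)) (Real.rpow_pos_of_pos hη0 _)
  set A := Set.Icc (-1 : ℝ) 1 \ Set.Ioo (-η) η with hA
  have hAm : MeasurableSet A := measurableSet_Icc.diff measurableSet_Ioo
  have hfc := continuous_of_mem_polySpace hf
  set F : EuclideanSpace ℝ (Fin d) → ℝ≥0∞ :=
    D.indicator fun y => ENNReal.ofReal (f y ^ 2) with hF
  have hFm : Measurable F :=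
    ((hfc.pow 2).measurable.ennreal_ofReal).indicator hD.isClosed.measurableSet
  have hFint : ∫⁻ y, F y = ENNReal.ofReal (∫ y in D, f y ^ 2) := by
    rw [lintegral_indicator hD.isClosed.measurableSet, ofReal_integral_eq_lintegral_ofReal
      (f := fun y => f y ^ 2) ((hfc.pow 2).continuousOn.integrableOn_compact hD) (ae_of_all _ fun y => sq_nonneg _)]
  have hcurve : ∀ t ∈ A, ∀ w ∈ Metric.closedBall (0 : Kᗮ) 1,
      x + ((α * t ^ 2) • u + (κ * t) • (w : EuclideanSpace ℝ (Fin d))) ∈ D := by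
    intro t ht w hw
    have hηt : η ≤ |t| := by
      by_contra! hlt
      exact ht.2 (abs_lt.1 hlt)
    have ht1 : t ^ 2 ≤ 1 := (sq_le_one_iff_abs_le_one t).2 (abs_le.2 ht.1)
    refine hcone (mem_coneTypeSet_of_norm_le hd hβ
      ⟨by positivity, mul_le_of_le_one_right hα.le ht1⟩ hu ?_ ?_)
    · rw [inner_smul_right, Submodule.mem_orthogonal_singleton_iff_inner_right.1 w.2, mul_zero]
    · refine le_trans ?_ (mul_abs_le_mul_rpow_sq hα hβ hs hη0 hηt)
      rw [norm_smul, Real.norm_eq_abs, abs_mul, abs_of_pos hκ0]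
      exact mul_le_of_le_one_right (by positivity) (by simpa using hw)
  have hline : ∀ w ∈ Metric.closedBall (0 : Kᗮ) 1, ENNReal.ofReal (f x ^ 2)
      ≤ ENNReal.ofReal (20 * n) *
        ∫⁻ t in A, F (x + ((α * t ^ 2) • u + (κ * t) • (w : EuclideanSpace ℝ (Fin d)))) := by
    intro w hw
    obtain ⟨Q, hQ, hQf⟩ := exists_polynomial_eval_parabola hf x (α • u)
      (κ • (w : EuclideanSpace ℝ (Fin d)))
    have hint : IntegrableOn (fun t => Q.eval t ^ 2) A :=
      ((Q.continuous.pow 2).continuousOn.integrableOn_Icc).mono_set Set.sdiff_subset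
    have h0 : Q.eval 0 = f x := by simp [hQf]
    rw [← h0]
    refine (ofReal_le_ofReal (Q.eval_zero_sq_le_integral hn hQ)).trans ?_
    rw [ofReal_mul (by positivity),
      ofReal_integral_eq_lintegral_ofReal hint (ae_of_all _ fun t => sq_nonneg _)]
    gcongr _ * ?_
    refine setLIntegral_mono' hAm fun t ht => ?_
    rw [hF, Set.indicator_of_mem (hcurve t ht w hw), hQf]
    simp only [smul_smul, mul_comm, le_refl]
  have hmeas : Measurable fun p : Kᗮ × ℝ =>
      F (x + ((α * p.2 ^ 2) • u + (κ * p.2) • (p.1 : EuclideanSpace ℝ (Fin d)))) := by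
    refine hFm.comp ?_
    fun_prop
  have hmain : ENNReal.ofReal (f x ^ 2 * ω) ≤ ENNReal.ofReal
      (20 * n * (((κ * η) ^ (d - 1))⁻¹ * (α * η)⁻¹) * ∫ y in D, f y ^ 2) := by
    calc ENNReal.ofReal (f x ^ 2 * ω)
        = ∫⁻ w in Metric.closedBall (0 : Kᗮ) 1, ENNReal.ofReal (f x ^ 2) := by
          rw [setLIntegral_const, hball, ofReal_mul (sq_nonneg _)]
      _ ≤ ∫⁻ w in Metric.closedBall (0 : Kᗮ) 1, ENNReal.ofReal (20 * n) *
            ∫⁻ t in A, F (x + ((α * t ^ 2) • u + (κ * t) • (w : EuclideanSpace ℝ (Fin d)))) :=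
          setLIntegral_mono' Metric.isClosed_closedBall.measurableSet hline
      _ = ENNReal.ofReal (20 * n) * ∫⁻ t in A, ∫⁻ w in Metric.closedBall (0 : Kᗮ) 1,
            F (x + ((α * t ^ 2) • u + (κ * t) • (w : EuclideanSpace ℝ (Fin d)))) := by
          rw [lintegral_const_mul' _ _ ofReal_ne_top, lintegral_lintegral_swap]
          exact hmeas.aemeasurable
      _ ≤ ENNReal.ofReal (20 * n) * ∫⁻ t in A, ∫⁻ w : Kᗮ,
            F (x + ((α * t ^ 2) • u + (κ * t) • (w : EuclideanSpace ℝ (Fin d)))) := by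
          gcongr
          exact Measure.restrict_le_self
      _ ≤ ENNReal.ofReal (20 * n) *
            (ENNReal.ofReal (((κ * η) ^ (d - 1))⁻¹ * (α * η)⁻¹) * ∫⁻ y, F y) := by
          gcongr
          exact lintegral_parabolas_le x hu hFm hα hη0 hκ0 hk
      _ = _ := by
          rw [hFint, ← mul_assoc, ← ofReal_mul (by positivity), ← ofReal_mul (by positivity)]
  have hI0 : 0 ≤ ∫ y in D, f y ^ 2 := integral_nonneg fun y => sq_nonneg _
  have hreal := (ofReal_le_ofReal_iff (by positivity)).1 hmain
  have hconst := mul_le_mul_of_nonneg_right (parabola_constant_le hα hβ hs (d - 1) hn) hI0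
  rw [mul_assoc, inv_mul_eq_div, le_div_iff₀ hω]
  exact hreal.trans hconst

/-- A set containing a cone-type set contains a nonempty open set. -/
theorem exists_isOpen_subset_coneTypeSet {d : ℕ} (hd : 2 ≤ d) {α β s : ℝ} (hα : 0 < α)
    (hβ : 0 < β) (hs : 0 ≤ s) {x u : EuclideanSpace ℝ (Fin d)} (hu : ‖u‖ = 1) :
    ∃ U : Set (EuclideanSpace ℝ (Fin d)), IsOpen U ∧ U.Nonempty ∧ U ⊆ coneTypeSet x u α β s := by
  have hc : Continuous fun y : EuclideanSpace ℝ (Fin d) => inner ℝ u (y - x) := by fun_prop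
  have hcs : Continuous fun y : EuclideanSpace ℝ (Fin d) => β * (inner ℝ u (y - x)) ^ s :=
    continuous_const.mul (hc.rpow_const fun _ => Or.inr hs)
  have hcw : Continuous fun y : EuclideanSpace ℝ (Fin d) =>
      ‖(y - x) - (inner ℝ u (y - x) : ℝ) • u‖ := by fun_prop
  have huu : (inner ℝ u u : ℝ) = 1 := by rw [real_inner_self_eq_norm_sq, hu, one_pow]
  refine ⟨{y | inner ℝ u (y - x) ∈ Set.Ioo 0 α} ∩
    {y | ‖(y - x) - (inner ℝ u (y - x) : ℝ) • u‖ < β * (inner ℝ u (y - x)) ^ s},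
    (isOpen_Ioo.preimage hc).inter (isOpen_lt hcw hcs), ⟨x + (α / 2) • u, ?_, ?_⟩, ?_⟩
  · simp only [Set.mem_ofPred_eq, add_sub_cancel_left, inner_smul_right, huu, mul_one]
    exact ⟨by linarith, by linarith⟩
  · simp only [Set.mem_ofPred_eq, add_sub_cancel_left, inner_smul_right, huu, mul_one, sub_self,
      norm_zero]
    positivity
  · rintro y ⟨hy1, hy2⟩
    have h := mem_coneTypeSet_of_norm_le (x := x) hd hβ (Set.Ioo_subset_Icc_self hy1) hu
      (w := (y - x) - (inner ℝ u (y - x) : ℝ) • u)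
      (by rw [inner_sub_right, inner_smul_right, huu, mul_one, sub_self]) hy2.le
    simpa using h

theorem hasOrthonormalBasisOn_polySpace {d n : ℕ} {D U : Set (EuclideanSpace ℝ (Fin d))}
    (hD : IsCompact D) (hU : IsOpen U) (hne : U.Nonempty) (hUD : U ⊆ D) :
    HasOrthonormalBasisOn (polySpace d n) D volume := by
  refine hasOrthonormalBasisOn_of_posDef _ _ _
    (fun f hf g hg => integrableOn_mul_of_mem_polySpace hD hf hg) fun f hf h0 => ?_
  have hfc := continuous_of_mem_polySpace hf
  have hae := (integral_eq_zero_iff_of_nonneg (fun y => mul_self_nonneg (f y))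
    (integrableOn_mul_of_mem_polySpace hD hf hf)).1 h0
  have heq := Measure.eqOn_open_of_ae_eq (ae_restrict_of_ae_restrict_of_subset hUD hae) hU
    (hfc.mul hfc).continuousOn continuousOn_const
  exact eq_zero_of_mem_polySpace_of_eqOn_open hf hU hne fun y hy => mul_self_eq_zero.1 (heq hy)

theorem mainTheorem4 (d : ℕ) (hd : 2 ≤ d) (α β : ℝ) (hα : 0 < α) (hβ : 0 < β) :
    ∃ c : ℝ, 0 < c ∧
      ∀ s ∈ Set.Icc (1 / 2 : ℝ) 1,
      ∀ (D : Set (EuclideanSpace ℝ (Fin d))) (x u : EuclideanSpace ℝ (Fin d)),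
        IsCompact D → x ∈ D → ‖u‖ = 1 → coneTypeSet x u α β s ⊆ D →
        ∀ n : ℕ, 1 ≤ n →
          HasOrthonormalBasisOn (polySpace d n) D MeasureTheory.volume ∧
          christoffelC (polySpace d n) D MeasureTheory.volume x
            ≤ c * (n : ℝ) ^ (2 + 2 * s * ((d : ℝ) - 1)) := by
  set ω : ℝ := √Real.pi ^ (d - 1) / Real.Gamma (((d - 1 : ℕ) : ℝ) / 2 + 1) with hω
  have hω0 : 0 < ω := div_pos (pow_pos (Real.sqrt_pos.2 Real.pi_pos) _)
    (Real.Gamma_pos_of_pos (by positivity))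
  have hm : 0 < min α 1 := lt_min hα one_pos
  refine ⟨ω⁻¹ * (20 * ((β * min α 1) ^ (d - 1))⁻¹ * α⁻¹ * 40 ^ (2 * (d - 1) + 1)),
    by positivity, fun s hs D x u hD _ hu hcone n hn => ?_⟩
  obtain ⟨U, hU, hne, hUc⟩ := exists_isOpen_subset_coneTypeSet (x := x) hd hα hβ
    (by linarith [hs.1] : 0 ≤ s) hu
  have hbasis := hasOrthonormalBasisOn_polySpace (n := n) hD hU hne (hUc.trans hcone)
  have hk := finrank_orthogonal_span_unit (by omega) hu
  have := nontrivial_orthogonal_span_unit hd hu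
  refine ⟨hbasis, christoffelC_le_of_sq_le hbasis x (by positivity) fun f hf => ?_⟩
  have h := sq_le_integral_of_coneTypeSet_subset hd hα hβ hs hD hu hcone hn hf hω0
    (by rw [InnerProductSpace.volume_closedBall, hk, ENNReal.ofReal_one, one_pow, one_mul])
  rw [Nat.cast_sub (by omega), Nat.cast_one] at h
  rwa [← mul_assoc] at h
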